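/- A partial Steiner triple system (partial STS) is a set $M$ with a collection of 3-element subsets, called blocks, such that any two distinct points lie in at most one block; it is a Steiner triple system (STS) if any two distinct points lie in exactly one block. It is regarded as a first-order structure in the language with one ternary relation symbol $R$, where $R(x,y,z)$ holds if and only if $\{x,y,z\}$ is a block. A partial STS $M$ is unconfined if $M\neq\emptyset$ and every nonempty finite $F\subseteq M$ contains a point that belongs to at most one block contained in $F$. An HF-ordering of $M$ is a linear ordering $<$ of $M$ such that for every $a\in M$ there is at most one block $\{a,a_1,a_2\}$ with $a_1,a_2<a$. For $A\subseteq M$, it is an HF-ordering over $A$ if moreover for every $a\in M\smallsetminus A$ there is at most one block $\{a,a_1,a_2\}$ such that, for each $i$, $a_i<a$ or $a_i\in A$. We write $A\leq M$ ($A$ is strong in $M$) if there is an HF-ordering of $M$ over $A$. For $A\subseteq M$, $\operatorname{acl}(A)$ is the union of all finite subsets of $M$ that are first-order definable with parameters from $A$. Let $M$ be an unconfined STS. (1) If $A\subseteq M$ and $A=\operatorname{acl}(A)$, then $A\leq M$, that is, $M$ has an HF-ordering over $A$. (2) If $N\preccurlyeq M$ is an elementary substructure, then $N\leq M$. -/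

import Mathlib

namespace Steiner

/-- A partial Steiner triple system: 3-element blocks, any two distinct points
lying in at most one block. -/
class PartialSTS (M : Type*) where
  blocks : Set (Set M)
  ncard_block : ∀ B ∈ blocks, B.ncard = 3
  block_unique : ∀ x y : M, x ≠ y → ∀ B ∈ blocks, ∀ C ∈ blocks,
    x ∈ B → y ∈ B → x ∈ C → y ∈ C → B = C

/-- A Steiner triple system: any two distinct points lie in exactly one block. -/
class STS (M : Type*) extends PartialSTS M where
  exists_block : ∀ x y : M, x ≠ y → ∃ B ∈ blocks, x ∈ B ∧ y ∈ B

/-- The only symbol of the language of (partial) Steiner triple systems: a ternary relation. -/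
inductive BlockRel : ℕ → Type
  | block : BlockRel 3

/-- The first-order language with one ternary relation symbol. -/
def language : FirstOrder.Language.{0, 0} where
  Functions := fun _ => Empty
  Relations := BlockRel

/-- A partial Steiner triple system as a first-order structure: the relation holds of
`(x, y, z)` iff `{x, y, z}` is a block (in particular the three points are distinct). -/
instance instStructure (M : Type*) [PartialSTS M] : language.Structure M where
  funMap := fun f => Empty.elim f
  RelMap := fun {_} r => match r with
    | BlockRel.block => fun v => ({v 0, v 1, v 2} : Set M) ∈ PartialSTS.blocks

/-- Model-theoretic algebraic closure: `acl(A)` is the union of the finite subsets of `M`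
that are first-order definable with parameters in `A`. -/
def acl (L : FirstOrder.Language) {M : Type*} [L.Structure M] (A : Set M) : Set M :=
  {b | ∃ s : Set M, s.Finite ∧ A.Definable₁ L s ∧ b ∈ s}

/-- A partial STS is unconfined if it is nonempty and each nonempty finite set `F` of its points
has a point lying in at most one block contained in `F`. -/
def Unconfined (M : Type*) [PartialSTS M] : Prop :=
  Nonempty M ∧ ∀ F : Set M, F.Finite → F.Nonempty →
    ∃ a ∈ F, {B ∈ PartialSTS.blocks | B ⊆ F ∧ a ∈ B}.Subsingleton

/-- An HF-ordering: a strict linear ordering such that each point `a` lies in at most one block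
whose other two points are smaller than `a`. -/
structure IsHFOrdering {M : Type*} [PartialSTS M] (lt : M → M → Prop) : Prop where
  strictTotal : IsStrictTotalOrder M lt
  subsingleton_blocks : ∀ a : M,
    {B ∈ PartialSTS.blocks | a ∈ B ∧ ∀ x ∈ B, x ≠ a → lt x a}.Subsingleton

/-- An HF-ordering over `A`: an HF-ordering such that each point `a` outside `A` lies in at most
one block whose other two points are each smaller than `a` or in `A`. -/
structure IsHFOrderingOver {M : Type*} [PartialSTS M] (A : Set M) (lt : M → M → Prop) : Prop
    extends IsHFOrdering lt where
  subsingleton_blocks_over : ∀ a : M, a ∉ A →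
    {B ∈ PartialSTS.blocks | a ∈ B ∧ ∀ x ∈ B, x ≠ a → lt x a ∨ x ∈ A}.Subsingleton

/-- `A ≤ M`: the set `A` of points of `M` is strong in `M`. -/
def Strong {M : Type*} [PartialSTS M] (A : Set M) : Prop :=
  ∃ lt : M → M → Prop, IsHFOrderingOver A lt

end Steiner

/-!
An elementary substructure `N` satisfies `acl N = N`, so everything reduces to algebraically
closed sets `A`.

The heart of the matter is that a finite `F ⊈ A` has a point `a`, outside `A`, lying in at most one
block contained in `F`. Suppose not, and let `V` be the union of the blocks contained in `F` but
not in `A`. The set `V` is finite, each point of `V \ A` lies in two blocks inside `V`, and each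
point of `V ∩ A` lies in a block inside `V` that leaves `A`. Injections of `V` into `M` that fix
`V ∩ A` and preserve blocks form an `A`-definable set of tuples. Since no point of `V \ A` is
algebraic over `A`, one such map `h` sends `V \ A` to a set disjoint from `V \ A`
(`exists_disjoint_copy`). In `V ∪ h(V)` every point lies in two blocks: for a point of `V ∩ A` these
are a block leaving `A` and its image under `h`. This contradicts unconfinedness
(`not_confined_over`).

The disjoint tuple comes from a finite form of Neumann's lemma, `exists_range_disjoint`. If a tuple
`e` met all tuples of a definable set `S` containing it, a minimal set of entries of `e` meeting all
of them would consist of points critical for transversals of `S` of bounded size. By branching there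
are only finitely many such points (`finite_setOf_critical`), and they form a definable set, so they
are algebraic.

Placing the point `a` last and recursing orders every finite `F` with `F ∩ A` as an initial segment
(`exists_rank`); an ultrafilter on the finite subsets of `M` glues these orders into an
HF-ordering of `M` with `A` as an initial segment, which is an HF-ordering over `A`.
-/

open FirstOrder FirstOrder.Language Set Filter

namespace Steiner

/-! ### Finite transversals of families of finite sets -/

/-- Only finitely many points `y` complete a set `T` of size at most `k` that is not a transversal
of `𝓕` to a transversal `T ∪ {y}`. Branching on a fixed `S₀ ∈ 𝓕`: either `y ∈ S₀`, or some
`z ∈ T` is in `S₀`, and then `T \ {z}` does the same for the members of `𝓕` that avoid `z`. -/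
theorem finite_setOf_critical {X : Type*} (k : ℕ) (𝓕 : Set (Set X)) (h𝓕 : ∀ S ∈ 𝓕, S.Finite) :
    {y | ∃ T : Finset X, T.card ≤ k ∧ (∀ S ∈ 𝓕, y ∈ S ∨ ∃ z ∈ T, z ∈ S) ∧
      ∃ S ∈ 𝓕, ∀ z ∈ T, z ∉ S}.Finite := by
  classical
  induction k generalizing 𝓕 with
  | zero =>
    by_cases hne : 𝓕.Nonempty
    · obtain ⟨S, hS⟩ := hne
      refine (h𝓕 S hS).subset ?_
      rintro y ⟨T, hT, hy, -⟩
      obtain rfl : T = ∅ := Finset.card_eq_zero.1 (Nat.le_zero.1 hT)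
      simpa using hy S hS
    · convert Set.finite_empty
      ext y
      simp only [mem_ofPred_eq, mem_empty_iff_false, iff_false]
      rintro ⟨T, -, -, S, hS, -⟩
      exact hne ⟨S, hS⟩
  | succ k ih =>
    by_cases hne : 𝓕.Nonempty
    · obtain ⟨S₀, hS₀⟩ := hne
      refine ((h𝓕 S₀ hS₀).union ((h𝓕 S₀ hS₀).biUnion fun z _ =>
        ih {S ∈ 𝓕 | z ∉ S} fun S hS => h𝓕 S hS.1)).subset ?_
      rintro y ⟨T, hT, hy, S₁, hS₁, hd⟩
      rcases hy S₀ hS₀ with h | ⟨z, hzT, hz⟩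
      · exact Or.inl h
      · refine Or.inr (mem_biUnion hz ⟨T.erase z, ?_, ?_, S₁, ⟨hS₁, hd z hzT⟩, ?_⟩)
        · have := Finset.card_erase_of_mem hzT
          omega
        · rintro S ⟨hS, hzS⟩
          rcases hy S hS with h | ⟨w, hw, hwS⟩
          · exact Or.inl h
          · exact Or.inr ⟨w, Finset.mem_erase.2 ⟨fun h => hzS (h ▸ hwS), hw⟩, hwS⟩
        · exact fun w hw => hd w (Finset.mem_of_mem_erase hw)
    · convert Set.finite_empty
      ext y
      simp only [mem_ofPred_eq, mem_empty_iff_false, iff_false]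
      rintro ⟨T, -, -, S, hS, -⟩
      exact hne ⟨S, hS⟩

/-! ### Definable sets of tuples and algebraic closure -/

theorem definable_setOf_eq_apply {L : Language} {M : Type*} [L.Structure M] (A : Set M)
    {α : Type*} (i j : α) : A.Definable L {v : α → M | v i = v j} :=
  DefinableFun.ofPred_eq (DefinableFun.proj L) (DefinableFun.proj L)

/-- Meeting every tuple of a definable set `S` is a definable condition on a tuple `w`. -/
theorem definable_setOf_hits {L : Language} {M : Type*} [L.Structure M] {A : Set M}
    {α β : Type*} [Finite α] [Finite β] {S : Set (α → M)} (hS : A.Definable L S) :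
    A.Definable L {w : β → M | ∀ g ∈ S, ∃ i j, w j = g i} := by
  have h1 : A.Definable L {w : β ⊕ α → M | w ∘ Sum.inr ∈ S} := hS.preimage_comp Sum.inr
  have h2 : A.Definable L (⋃ i : α, ⋃ j : β, {w : β ⊕ α → M | w (Sum.inl j) = w (Sum.inr i)}) :=
    definable_iUnion_of_finite fun i => definable_iUnion_of_finite fun j =>
      definable_setOf_eq_apply A _ _
  convert (h1.himp h2).forall_of_finite using 1
  ext w
  simp [himp_eq, or_iff_not_imp_right]

/-- A finite form of Neumann's lemma: a definable set of tuples containing a tuple `e` none of whose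
entries is algebraic also contains a tuple disjoint from `e`. -/
theorem exists_range_disjoint {L : Language} {M : Type*} [L.Structure M] {A : Set M}
    {α : Type*} [Finite α] {S : Set (α → M)} (hS : A.Definable L S) {e : α → M} (he : e ∈ S)
    (hA : ∀ i, e i ∉ acl L A) : ∃ g ∈ S, Disjoint (range g) (range e) := by
  classical
  by_contra! hcon
  let Hits : Set M → Prop := fun T => ∀ g ∈ S, ∃ i, g i ∈ T
  have hhit : Hits (range e) := by
    intro g hg
    obtain ⟨x, ⟨i, rfl⟩, hx⟩ := Set.not_disjoint_iff.1 (hcon g hg)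
    exact ⟨i, hx⟩
  obtain ⟨T, hTe, hT⟩ := Set.Finite.exists_le_minimal
    (s := {T : Set M | T ⊆ range e ∧ Hits T}) ((finite_range e).finite_subsets.subset
      fun T hT => hT.1) (a := range e) ⟨subset_rfl, hhit⟩
  obtain ⟨i₀, hi₀⟩ := hT.prop.2 e he
  set y := e i₀
  have hTfin : T.Finite := (finite_range e).subset hT.prop.1
  have hnot : ¬ Hits (T \ {y}) := fun h =>
    (hT.le_of_le ⟨sdiff_subset.trans hT.prop.1, h⟩ sdiff_subset hi₀).2 rfl
  let β := ↥(T \ {y})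
  have : Finite β := hTfin.sdiff.to_subtype
  -- `D` is the set of critical points for transversals of size at most `|T|`; it contains `y`, as
  -- witnessed by an enumeration of `T \ {y}`, so `y` is algebraic once `D` is definable and finite.
  let D : Set M := {z | ∃ t : β → M, (∀ g ∈ S, ∃ i, z = g i ∨ ∃ j, t j = g i) ∧
    ¬ ∀ g ∈ S, ∃ i j, t j = g i}
  have hDdef : A.Definable₁ L D := by
    have h1 := definable_setOf_hits (β := Fin 1 ⊕ β) hS
    have h2 : A.Definable L {w : Fin 1 ⊕ β → M | ∀ g ∈ S, ∃ i j, (w ∘ Sum.inr) j = g i} :=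
      (definable_setOf_hits (β := β) hS).preimage_comp Sum.inr
    unfold Set.Definable₁
    convert (h1.inter h2.compl).exists_of_finite using 1
    ext v
    simp [D]
  have hDfin : D.Finite := by
    have := Fintype.ofFinite β
    refine (finite_setOf_critical (Fintype.card β) (range '' S) ?_).subset ?_
    · rintro _ ⟨g, -, rfl⟩
      exact finite_range g
    · rintro z ⟨t, h1, h2⟩
      push Not at h2
      obtain ⟨g, hg, hgt⟩ := h2
      refine ⟨Finset.univ.image t, Finset.card_image_le, ?_, range g, ⟨g, hg, rfl⟩, ?_⟩
      · rintro _ ⟨f, hf, rfl⟩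
        obtain ⟨i, rfl | ⟨j, hj⟩⟩ := h1 f hf
        · exact Or.inl ⟨i, rfl⟩
        · exact Or.inr ⟨t j, by simp, i, hj.symm⟩
      · intro z hz
        obtain ⟨j, -, rfl⟩ := Finset.mem_image.1 hz
        rintro ⟨i, hi⟩
        exact hgt i j hi.symm
  refine hA i₀ ⟨D, hDfin, hDdef, Subtype.val, ?_, ?_⟩
  · intro g hg
    obtain ⟨i, hi⟩ := hT.prop.2 g hg
    by_cases h : g i = y
    · exact ⟨i, Or.inl h.symm⟩
    · exact ⟨i, Or.inr ⟨⟨g i, hi, h⟩, rfl⟩⟩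
  · intro h
    refine hnot fun g hg => ?_
    obtain ⟨i, j, hj⟩ := h g hg
    exact ⟨i, hj ▸ j.2⟩

theorem acl_coe_elementarySubstructure {L : Language} {M : Type*} [L.Structure M]
    (N : L.ElementarySubstructure M) : acl L (N : Set M) = N := by
  apply Subset.antisymm
  · rintro b ⟨s, hsf, hs, hb⟩
    by_contra hbN
    have hfin : (s ∩ N).Finite := hsf.inter_of_left _
    -- Removing the finitely many points of `N` from `s` leaves a nonempty set definable over `N`,
    -- which must therefore meet `N`.
    have hdef : (N : Set M).Definable₁ L (s \ (s ∩ N)) := by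
      have h : (N : Set M).Definable L
          (⋃ a ∈ hfin.toFinset, ({x : Fin 1 → M | x 0 = a} ∩ {x | a ∈ N})) :=
        definable_biUnion_finset (fun a => by
          by_cases ha : a ∈ N
          · have := Definable.singleton_of_mem L (A := (N : Set M)) ha
            unfold Set.Definable₁ at this
            simpa [ha] using this
          · simp [ha]) _
      unfold Set.Definable₁ at hs ⊢
      convert hs.sdiff h using 1
      ext x
      simp
      grind
    obtain ⟨c, hc, hcN⟩ := N.meetsDefinable (s \ (s ∩ N)) ⟨b, hb, fun h => hbN h.2⟩ hdef
    grind
  · intro a ha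
    exact ⟨{a}, finite_singleton a, Definable.singleton_of_mem L ha, rfl⟩

/-! ### Finite configurations over an algebraically closed set -/

section PartialSTS

variable {M : Type*} [PartialSTS M]

theorem definable_setOf_block (A : Set M) {α : Type*} (i j k : α) :
    A.Definable language {v : α → M | ({v i, v j, v k} : Set M) ∈ PartialSTS.blocks} := by
  refine Definable.mono ?_ (empty_subset A)
  refine empty_definable_iff.2 ⟨Relations.formula (L := language) (n := 3) BlockRel.block
    (fun l => Term.var (![i, j, k] l)), ?_⟩
  ext v
  exact (Formula.realize_rel (L := language) (R := BlockRel.block)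
    (ts := fun l => Term.var (![i, j, k] l)) (v := v)).symm

/-- A finite `V` has a copy over the algebraically closed set `A` whose points coming from `V \ A`
are all new. -/
theorem exists_disjoint_copy {A : Set M} (hA : acl language A = A) {V : Set M} (hV : V.Finite) :
    ∃ h : M → M, InjOn h V ∧ (∀ a ∈ V ∩ A, h a = a) ∧
      (∀ B ∈ PartialSTS.blocks, B ⊆ V → h '' B ∈ PartialSTS.blocks) ∧
      ∀ a ∈ V \ A, ∀ b ∈ V \ A, h a ≠ b := by
  classical
  have : Finite V := hV
  -- The injective block-preserving maps `V → M` that are the identity on `V ∩ A`.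
  let S : Set (V → M) := (⋂ u : {u : V // (u : M) ∈ A}, {g | g u = u}) ∩
    (⋂ p : {p : V × V // p.1 ≠ p.2}, {g | g p.1.1 = g p.1.2}ᶜ) ∩
    ⋂ p : {p : V × V × V // ({(p.1 : M), (p.2.1 : M), (p.2.2 : M)} : Set M) ∈ PartialSTS.blocks},
      {g | ({g p.1.1, g p.1.2.1, g p.1.2.2} : Set M) ∈ PartialSTS.blocks}
  have hS : A.Definable language S := by
    refine ((definable_iInter_of_finite fun u => ?_).inter
      (definable_iInter_of_finite fun p => ?_)).inter (definable_iInter_of_finite fun p => ?_)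
    · exact DefinableFun.ofPred_eq_const (DefinableFun.proj _) u.2
    · exact (definable_setOf_eq_apply A _ _).compl
    · exact definable_setOf_block A _ _ _
  have hval : (Subtype.val : V → M) ∈ S := by
    refine ⟨⟨mem_iInter.2 fun u => rfl, mem_iInter.2 fun p h => p.2 (Subtype.ext h)⟩,
      mem_iInter.2 fun p => p.2⟩
  obtain ⟨_, ⟨g, hg, rfl⟩, hd⟩ := exists_range_disjoint
    (hS.image_comp (Subtype.val : {u : V // (u : M) ∉ A} → V)) ⟨_, hval, rfl⟩
    (fun i => by rw [hA]; exact i.2)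
  obtain ⟨⟨hg1, hg2⟩, hg3⟩ := hg
  simp only [mem_iInter, mem_compl_iff, mem_ofPred_eq] at hg1 hg2 hg3
  have hext : ∀ u (hu : u ∈ V), (if h : u ∈ V then g ⟨u, h⟩ else u) = g ⟨u, hu⟩ :=
    fun u hu => dif_pos hu
  refine ⟨fun u => if h : u ∈ V then g ⟨u, h⟩ else u, ?_, ?_, ?_, ?_⟩
  · intro u hu v hv huv
    by_contra hne
    simp only [hext u hu, hext v hv] at huv
    exact hg2 ⟨(⟨u, hu⟩, ⟨v, hv⟩), fun h => hne (congrArg Subtype.val h)⟩ huv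
  · rintro a ⟨haV, haA⟩
    simp only [hext a haV]
    exact hg1 ⟨⟨a, haV⟩, haA⟩
  · intro B hB hBV
    obtain ⟨x, y, z, -, -, -, rfl⟩ := ncard_eq_three.1 (PartialSTS.ncard_block B hB)
    have hx : x ∈ V := hBV (by simp)
    have hy : y ∈ V := hBV (by simp)
    have hz : z ∈ V := hBV (by simp)
    rw [image_insert_eq, image_insert_eq, image_singleton, hext x hx, hext y hy, hext z hz]
    exact hg3 ⟨(⟨x, hx⟩, ⟨y, hy⟩, ⟨z, hz⟩), hB⟩
  · rintro a ⟨haV, haA⟩ b ⟨hbV, hbA⟩ hab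
    simp only [hext a haV] at hab
    exact disjoint_left.1 hd ⟨⟨⟨a, haV⟩, haA⟩, rfl⟩ ⟨⟨⟨b, hbV⟩, hbA⟩, hab.symm⟩

/-- A finite nonempty `V` over an algebraically closed `A` as in the hypotheses would, together with
a disjoint copy of itself over `A`, make a confined set. -/
theorem not_confined_over (hM : Unconfined M) {A : Set M} (hA : acl language A = A)
    {V : Set M} (hV : V.Finite) (hne : V.Nonempty)
    (h2 : ∀ a ∈ V \ A, {B ∈ PartialSTS.blocks | B ⊆ V ∧ a ∈ B}.Nontrivial)
    (h1 : ∀ a ∈ V ∩ A, ∃ B ∈ PartialSTS.blocks, B ⊆ V ∧ a ∈ B ∧ ¬ B ⊆ A) : False := by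
  obtain ⟨h, hinj, hfix, hbl, hdisj⟩ := exists_disjoint_copy hA hV
  obtain ⟨a, ha, hsub⟩ := hM.2 (V ∪ h '' V) (hV.union (hV.image h)) (hne.mono subset_union_left)
  have himg : ∀ B ⊆ V, h '' B ⊆ V ∪ h '' V := fun B hB =>
    (image_mono hB).trans subset_union_right
  rw [← not_nontrivial_iff] at hsub
  apply hsub
  by_cases haV : a ∈ V
  · by_cases haA : a ∈ A
    · obtain ⟨B, hB, hBV, haB, hBA⟩ := h1 a ⟨haV, haA⟩
      obtain ⟨b, hb, hbA⟩ := not_subset.1 hBA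
      refine ⟨B, ⟨hB, hBV.trans subset_union_left, haB⟩, h '' B,
        ⟨hbl B hB hBV, himg B hBV, a, haB, hfix a ⟨haV, haA⟩⟩, fun heq => ?_⟩
      -- If `h '' B = B`, then `h b` is in `V`; it is not in `A`, where `h` is the identity, because
      -- `h` is injective and `b ∉ A`, and it is not in `V \ A` by disjointness.
      have hhb : h b ∈ B := heq ▸ mem_image_of_mem h hb
      by_cases hbA' : h b ∈ A
      · have := hinj (hBV hhb) (hBV hb) (hfix _ ⟨hBV hhb, hbA'⟩)
        exact hbA (this ▸ hbA')
      · exact hdisj b ⟨hBV hb, hbA⟩ _ ⟨hBV hhb, hbA'⟩ rfl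
    · refine (h2 a ⟨haV, haA⟩).mono ?_
      rintro B ⟨hB, hBV, haB⟩
      exact ⟨hB, hBV.trans subset_union_left, haB⟩
  · obtain ⟨b, hbV, rfl⟩ := ha.resolve_left haV
    have hbA : b ∉ A := fun hbA => haV ((hfix b ⟨hbV, hbA⟩).symm ▸ hbV)
    obtain ⟨B, ⟨hB, hBV, hbB⟩, C, ⟨hC, hCV, hbC⟩, hBC⟩ := h2 b ⟨hbV, hbA⟩
    exact ⟨h '' B, ⟨hbl B hB hBV, himg B hBV, b, hbB, rfl⟩, h '' C,
      ⟨hbl C hC hCV, himg C hCV, b, hbC, rfl⟩,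
      fun heq => hBC ((hinj.image_eq_image_iff hBV hCV).1 heq)⟩

/-- The point that can be placed last in an HF-ordering of `F` having `F ∩ A` as an initial
segment. -/
theorem exists_subsingleton_blocks (hM : Unconfined M) {A : Set M} (hA : acl language A = A)
    {F : Set M} (hF : F.Finite) (hne : F.Nonempty) :
    ∃ a ∈ F, (a ∈ A → F ⊆ A) ∧ {B ∈ PartialSTS.blocks | B ⊆ F ∧ a ∈ B}.Subsingleton := by
  by_cases hFA : F ⊆ A
  · obtain ⟨a, ha, h⟩ := hM.2 F hF hne
    exact ⟨a, ha, fun _ => hFA, h⟩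
  by_contra! hcon
  have hcon' : ∀ a ∈ F \ A, {B ∈ PartialSTS.blocks | B ⊆ F ∧ a ∈ B}.Nontrivial := fun a ha =>
    hcon a ha.1 fun h => absurd h ha.2
  let V : Set M := ⋃₀ {B ∈ PartialSTS.blocks | B ⊆ F ∧ ¬ B ⊆ A}
  have hVF : V ⊆ F := sUnion_subset fun B hB => hB.2.1
  have hsub : ∀ B ∈ (PartialSTS.blocks : Set (Set M)), B ⊆ F → ¬ B ⊆ A → B ⊆ V :=
    fun B hB hBF hBA => subset_sUnion_of_mem
      (show B ∈ {B ∈ PartialSTS.blocks | B ⊆ F ∧ ¬ B ⊆ A} from ⟨hB, hBF, hBA⟩)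
  have h2 : ∀ a ∈ F \ A, {B ∈ PartialSTS.blocks | B ⊆ V ∧ a ∈ B}.Nontrivial := fun a ha =>
    (hcon' a ha).mono fun B hB => ⟨hB.1, hsub B hB.1 hB.2.1 fun h => ha.2 (h hB.2.2), hB.2.2⟩
  obtain ⟨a, haF, haA⟩ := not_subset.1 hFA
  obtain ⟨B, ⟨-, hBV, haB⟩⟩ := (h2 a ⟨haF, haA⟩).nonempty
  refine not_confined_over hM hA (hF.subset hVF) ⟨a, hBV haB⟩
    (fun b hb => h2 b ⟨hVF hb.1, hb.2⟩) ?_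
  rintro b ⟨⟨C, ⟨hC, hCF, hCA⟩, hbC⟩, -⟩
  exact ⟨C, hC, hsub C hC hCF hCA, hbC, hCA⟩

/-! ### HF-orderings -/

/-- Every finite `F` has an HF-ordering with `F ∩ A` as an initial segment. The ordering is encoded
by a rank function on all of `M`, whose values outside `F` are irrelevant. -/
theorem exists_rank (hM : Unconfined M) {A : Set M} (hA : acl language A = A) (F : Finset M) :
    ∃ r : M → ℕ, InjOn r F ∧ (∀ x ∈ F, ∀ y ∈ F, x ∈ A → y ∉ A → r x < r y) ∧
      ∀ a ∈ F,
        {B ∈ PartialSTS.blocks | B ⊆ F ∧ a ∈ B ∧ ∀ x ∈ B, x ≠ a → r x < r a}.Subsingleton := by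
  classical
  induction F using Finset.strongInduction with
  | H F ih =>
    rcases F.eq_empty_or_nonempty with rfl | hne
    · exact ⟨fun _ => 0, by simp, by simp, by simp⟩
    obtain ⟨a, haF, haA, ha⟩ := exists_subsingleton_blocks hM hA F.finite_toSet
      (Finset.coe_nonempty.2 hne)
    obtain ⟨r, hinj, hr, hbl⟩ := ih (F.erase a) (Finset.erase_ssubset haF)
    -- `n` exceeds all ranks, so giving it to `a` puts `a` last.
    obtain ⟨n, hn⟩ : ∃ n, ∀ x ∈ F, r x < n :=
      ⟨F.sup r + 1, fun x hx => Nat.lt_succ_of_le (Finset.le_sup (f := r) hx)⟩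
    have hra : Function.update r a n a = n := Function.update_self ..
    have hrx : ∀ x, x ≠ a → Function.update r a n x = r x := fun x hx =>
      Function.update_of_ne hx ..
    refine ⟨Function.update r a n, ?_, ?_, ?_⟩
    · intro x hx y hy hxy
      by_cases hxa : x = a <;> by_cases hya : y = a
      · rw [hxa, hya]
      · subst hxa
        rw [hra, hrx y hya] at hxy
        exact absurd hxy (hn y hy).ne'
      · subst hya
        rw [hra, hrx x hxa] at hxy
        exact absurd hxy (hn x hx).ne
      · rw [hrx x hxa, hrx y hya] at hxy
        exact hinj (by simp_all) (by simp_all) hxy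
    · intro x hx y hy hxA hyA
      have hxa : x ≠ a := fun h => hyA (haA (h ▸ hxA) hy)
      rw [hrx x hxa]
      by_cases hya : y = a
      · rw [hya, hra]
        exact hn x hx
      · rw [hrx y hya]
        exact hr x (by simp_all) y (by simp_all) hxA hyA
    · intro b hb
      by_cases hba : b = a
      · subst hba
        exact ha.anti fun B hB => ⟨hB.1, hB.2.1, hB.2.2.1⟩
      · refine (hbl b (by simp_all)).anti ?_
        rintro B ⟨hB, hBF, hbB, hlt⟩
        -- The last point `a` is in no block counted for an earlier point `b`.
        have haB : a ∉ B := fun haB => by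
          have := hlt a haB (Ne.symm hba)
          rw [hra, hrx b hba] at this
          exact lt_asymm this (hn b hb)
        refine ⟨hB, fun x hx => ?_, hbB, fun x hx hxb => ?_⟩
        · exact Finset.mem_coe.2 (Finset.mem_erase.2 ⟨fun h => haB (h ▸ hx), hBF hx⟩)
        · have := hlt x hx hxb
          rwa [hrx b hba, hrx x fun h => haB (h ▸ hx)] at this

/-- The ordering of `M` is an ultralimit of orderings of its finite subsets: each failure of the
defining conditions involves finitely many points, hence would occur in one of these. -/
theorem strong_of_acl_eq (hM : Unconfined M) {A : Set M} (hA : acl language A = A) :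
    Strong A := by
  classical
  choose r hinj hinit hbl using exists_rank hM hA
  let U : Ultrafilter (Finset M) := Ultrafilter.of atTop
  have hmem : ∀ x : M, ∀ᶠ F in (U : Filter (Finset M)), x ∈ F := fun x =>
    Ultrafilter.of_le _ ((eventually_ge_atTop {x}).mono fun F hF => hF (Finset.mem_singleton_self x))
  let lt : M → M → Prop := fun x y => ∀ᶠ F in (U : Filter (Finset M)), r F x < r F y
  have hAlt : ∀ x ∈ A, ∀ y ∉ A, lt x y := fun x hx y hy => by
    filter_upwards [hmem x, hmem y] with F hxF hyF using hinit F x hxF y hyF hx hy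
  have hsub : ∀ a : M,
      {B ∈ PartialSTS.blocks | a ∈ B ∧ ∀ x ∈ B, x ≠ a → lt x a}.Subsingleton := by
    rintro a B ⟨hB, haB, hBlt⟩ C ⟨hC, haC, hClt⟩
    have key : ∀ D ∈ (PartialSTS.blocks : Set (Set M)), (∀ x ∈ D, x ≠ a → lt x a) →
        ∀ᶠ F in (U : Filter (Finset M)), ∀ x ∈ D, x ∈ F ∧ (x ≠ a → r F x < r F a) := by
      intro D hD hlt
      have hfin : D.Finite := finite_of_ncard_ne_zero (by simp [PartialSTS.ncard_block D hD])
      refine (eventually_all_finite hfin).2 fun x hx => (hmem x).and ?_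
      by_cases hxa : x = a
      · simp [hxa]
      · exact (hlt x hx hxa).mono fun F h _ => h
    obtain ⟨F, haF, hBF, hCF⟩ := ((hmem a).and ((key B hB hBlt).and (key C hC hClt))).exists
    exact hbl F a haF ⟨hB, fun x hx => (hBF x hx).1, haB, fun x hx => (hBF x hx).2⟩
      ⟨hC, fun x hx => (hCF x hx).1, haC, fun x hx => (hCF x hx).2⟩
  refine ⟨lt, ⟨⟨{ trichotomous := ?_, irrefl := ?_, trans := ?_ }, hsub⟩, ?_⟩⟩
  · intro x y hxy hyx
    rw [← Ultrafilter.eventually_not] at hxy hyx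
    obtain ⟨F, hxF, hyF, h1, h2⟩ := ((hmem x).and ((hmem y).and (hxy.and hyx))).exists
    exact hinj F hxF hyF (le_antisymm (not_lt.1 h2) (not_lt.1 h1))
  · intro x hx
    obtain ⟨F, hF⟩ := hx.exists
    exact lt_irrefl _ hF
  · intro x y z hxy hyz
    filter_upwards [hxy, hyz] with F h1 h2 using h1.trans h2
  · intro a ha
    -- All of `A` precedes `a ∉ A`, so the blocks over `A` are already counted by `hsub`.
    refine (hsub a).anti ?_
    rintro B ⟨hB, haB, h⟩
    exact ⟨hB, haB, fun x hx hxa => (h x hx hxa).elim id fun hxA => hAlt x hxA a ha⟩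

end PartialSTS

end Steiner

theorem mainTheorem11 {M : Type*} [Steiner.STS M] (hM : Steiner.Unconfined M) :
    (∀ A : Set M, Steiner.acl Steiner.language A = A → Steiner.Strong A) ∧
    (∀ N : Steiner.language.ElementarySubstructure M, Steiner.Strong (N : Set M)) :=
  ⟨fun _ hA => Steiner.strong_of_acl_eq hM hA,
    fun N => Steiner.strong_of_acl_eq hM (Steiner.acl_coe_elementarySubstructure N)⟩
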